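/- Let $X$ be the set of matrices $A=(a_{ij})\in\mathbb{R}^{n\times n}$ of Hamiltonian cycles of the complete graph $K_n$ ($a_{ij}=1$ if the cycle contains the edge $\{i,j\}$, and $a_{ij}=0$ otherwise), let $T_n=\operatorname{conv}(X)$ be the Symmetric Traveling Salesman Polytope, and let $Z=\frac{1}{|X|}\sum_{x\in X}x$ be its barycenter. There are absolute constants $C,D$ such that for all integers $n\ge 3$ and $1\le k\le n^{1/3}$ there exist a polytope $P_k^\circ\subset\mathbb{R}^N$ (for some $N$) with at most $C\,n^{4k}$ facets, a linear transformation $T:\mathbb{R}^N\to\mathbb{R}^{n\times n}$, and a constant $c_k>0$ with $$\Bigl|c_k-\frac{k}{n}\Bigr|\le\frac{D}{n}$$ such that $Q_k=T(P_k^\circ)$ satisfies $$c_k(Q_k-Z)\subset T_n-Z\subset Q_k-Z .$$ Here a facet of a polytope $P$ (not necessarily full-dimensional in $\mathbb{R}^N$) is a nonempty face of dimension $\dim P-1$. -/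

import Mathlib

open scoped Pointwise

noncomputable section

/-- The `0`-`1` matrix of a closed walk in the complete graph on `n` vertices: the entry `(i, j)`
is `1` if the walk contains the edge `{i, j}`, and `0` otherwise. -/
def walkMatrix {n : ℕ} {v : Fin n} (p : (⊤ : SimpleGraph (Fin n)).Walk v v) :
    Matrix (Fin n) (Fin n) ℝ :=
  Matrix.of fun i j => if s(i, j) ∈ p.edges then 1 else 0

/-- The set `X` of all incidence matrices of Hamiltonian cycles of the complete graph on `n`
vertices. -/
def hamiltonianCycleMatrices (n : ℕ) : Set (Matrix (Fin n) (Fin n) ℝ) :=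
  {A | ∃ (v : Fin n) (p : (⊤ : SimpleGraph (Fin n)).Walk v v),
    p.IsHamiltonianCycle ∧ A = walkMatrix p}

theorem hamiltonianCycleMatrices_finite (n : ℕ) : (hamiltonianCycleMatrices n).Finite := by
  refine (Set.finite_range fun f : Fin n → Fin n → Bool =>
    (Matrix.of fun i j => if f i j = true then (1 : ℝ) else 0)).subset ?_
  rintro A ⟨v, p, -, rfl⟩
  exact ⟨fun i j => decide (s(i, j) ∈ p.edges), by ext i j; simp [walkMatrix]⟩

/-- The Symmetric Traveling Salesman Polytope `T_n`. -/
def STSP (n : ℕ) : Set (Matrix (Fin n) (Fin n) ℝ) :=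
  convexHull ℝ (hamiltonianCycleMatrices n)

/-- The barycenter `Z` of `T_n`: the average `|X|⁻¹ ∑ x` of its vertices `x ∈ X`. -/
def stspBarycenter (n : ℕ) : Matrix (Fin n) (Fin n) ℝ :=
  (hamiltonianCycleMatrices_finite n).toFinset.centroid ℝ id

/-- A (convex) polytope: the convex hull of finitely many points. -/
def IsPolytope {E : Type*} [AddCommGroup E] [Module ℝ E] (P : Set E) : Prop :=
  ∃ S : Finset E, P = convexHull ℝ (S : Set E)

/-- `F` is a facet of `P`: a nonempty face (the set of maximizers on `P` of a linear functional)
whose dimension is one less than that of `P`, where the dimension of a set is that of its affine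
hull. In particular `P` need not be full-dimensional in the ambient space. -/
def IsFacet {E : Type*} [AddCommGroup E] [Module ℝ E] [TopologicalSpace E] (P F : Set E) : Prop :=
  F.Nonempty ∧ IsExposed ℝ P F ∧
    Module.finrank ℝ (vectorSpan ℝ F) + 1 = Module.finrank ℝ (vectorSpan ℝ P)

end

/-! It suffices to find few points of `STSP n` whose convex hull contains the contraction of `STSP
n` towards its barycenter `Z` by a factor `c`. Dilating that hull about `Z` by `c⁻¹` gives `Q_k`,
and a hull of `N` points is a linear image of a simplex, which has at most `N` facets.

The points come from `k`-matchings. Choose every third edge, `k` in all, of a Hamiltonian cycle `A`,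
and let `W` be the set of their endpoints. Averaging `A` over the permutations fixing `W` pointwise,
or preserving `W` as a set, stays in `STSP n` and forgets everything about `A` except the matching,
respectively except `W`. A convex combination of the two averages is `matchingPoint`. Its weight is
chosen so that each off-diagonal entry is affine in the matching matrix and in the indicators of `u
∈ W` and `v ∈ W`, with no product term (`matchingPoint_mem`).

Rotate the matching through all `n` positions along `A`. Every edge of `A` is used `k` times and
every vertex is covered `2k` times, so by affinity the mean of the points is `Z + c (A - Z)`, where
`c = (1 - mixWeight n k) k / n` (`sum_matchingPoint_cycleWindow`). There are at most `n ^ (2k)`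
points, and `mixWeight n k * k ≤ 1` puts `c` within `1 / n` of `k / n`. -/

/-! ### Facets of the simplex and its projections -/

/-- A facet of the standard simplex is one of its coordinate faces. -/
theorem IsFacet.stdSimplex_eq {ι : Type*} [Fintype ι] {F : Set (ι → ℝ)}
    (hF : IsFacet (stdSimplex ℝ ι) F) : ∃ i, F = {x ∈ stdSimplex ℝ ι | x i = 0} := by
  classical
  obtain ⟨hne, hexp, hdim⟩ := hF
  obtain ⟨l, hl⟩ := hexp hne
  obtain ⟨x₀, hx₀⟩ := hne
  have hx₀' := hx₀
  rw [hl] at hx₀'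
  obtain ⟨hx₀P, hx₀m⟩ := hx₀'
  set m := l x₀ with hm
  set a : ι → ℝ := fun i => l (Pi.single i 1) with ha
  have hlx (x : ι → ℝ) : l x = ∑ i, x i * a i := by
    conv_lhs => rw [pi_eq_sum_univ' x]
    simp only [map_sum, ha]
    refine Finset.sum_congr rfl fun i _ => ?_
    rw [← smul_eq_mul, ← map_smul]
  have ham (i : ι) : a i ≤ m := hx₀m _ (single_mem_stdSimplex ℝ i)
  have hFiff (x : ι → ℝ) : x ∈ F ↔ x ∈ stdSimplex ℝ ι ∧ ∀ i, a i < m → x i = 0 := by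
    rw [hl]
    constructor
    · rintro ⟨hx, hmax⟩
      refine ⟨hx, fun i hi => ?_⟩
      have h1 : ∑ j, x j * (m - a j) = 0 := by
        have h2 : l x = m := le_antisymm (hx₀m x hx) (hmax x₀ hx₀P)
        simp only [mul_sub, Finset.sum_sub_distrib, ← Finset.sum_mul, hx.2, ← hlx, h2]
        ring
      have h2 := (Finset.sum_eq_zero_iff_of_nonneg fun j _ =>
        mul_nonneg (hx.1 j) (sub_nonneg.2 (ham j))).1 h1 i (Finset.mem_univ i)
      exact (mul_eq_zero.1 h2).resolve_right (by linarith)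
    · rintro ⟨hx, h0⟩
      refine ⟨hx, fun y hy => ?_⟩
      have h1 : l x = m := by
        have : ∀ i, x i * a i = x i * m := fun i => by
          rcases (ham i).lt_or_eq with h | h
          · simp [h0 i h]
          · rw [h]
        rw [hlx]
        simp only [this, ← Finset.sum_mul, hx.2, one_mul]
      rw [h1]
      exact hx₀m y hy
  set K := vectorSpan ℝ (stdSimplex ℝ ι) with hK
  let e : ι → Module.Dual ℝ (ι → ℝ) := fun i => LinearMap.proj i
  have hker {G : Set (ι → ℝ)} {i : ι} (h : ∀ x ∈ G, x i = 0) :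
      vectorSpan ℝ G ≤ LinearMap.ker (e i) := by
    rw [vectorSpan_def, Submodule.span_le]
    rintro _ ⟨x, hx, y, hy, rfl⟩
    simp [e, h x hx, h y hy]
  have hFP : F ⊆ stdSimplex ℝ ι := fun x hx => ((hFiff x).1 hx).1
  have hFK : vectorSpan ℝ F ≤ K := vectorSpan_mono ℝ hFP
  obtain ⟨j, hj⟩ : ∃ j, x₀ j ≠ 0 := by
    by_contra! h
    have := hx₀P.2
    simp [h] at this
  have hdiff (i : ι) : (Pi.single i 1 - Pi.single j 1 : ι → ℝ) ∈ K :=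
    vsub_mem_vectorSpan ℝ (single_mem_stdSimplex ℝ i) (single_mem_stdSimplex ℝ j)
  obtain ⟨i, hi⟩ : ∃ i, a i < m := by
    by_contra! h
    have : F = stdSimplex ℝ ι := by
      ext x
      rw [hFiff]
      exact ⟨fun h => h.1, fun hx => ⟨hx, fun i hi => absurd hi (h i).not_gt⟩⟩
    rw [this] at hdim
    lia
  have hjm : ∀ i, a i < m → i ≠ j := by
    rintro i hi rfl
    exact hj (((hFiff x₀).1 hx₀).2 i hi)
  -- Two coordinates vanishing on `F` would give the chain `vectorSpan F < K ⊓ ker (e i) < K`, hence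
  -- codimension at least two.
  have huniq : ∀ i', a i' < m → i' = i := by
    intro i' hi'
    by_contra hii
    have h1 : K ⊓ LinearMap.ker (e i) < K := by
      refine lt_of_le_of_ne inf_le_left fun h => ?_
      have := h.symm ▸ hdiff i
      have := this.2
      simp [e, (hjm i hi)] at this
    have h2 : vectorSpan ℝ F < K ⊓ LinearMap.ker (e i) := by
      refine lt_of_le_of_ne (le_inf hFK (hker fun x hx => ((hFiff x).1 hx).2 i hi)) fun h => ?_
      have h3 : (Pi.single i' 1 - Pi.single j 1 : ι → ℝ) ∈ vectorSpan ℝ F := by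
        rw [h]
        refine ⟨hdiff i', ?_⟩
        simp [e, Ne.symm hii, hjm i hi]
      have := hker (fun x hx => ((hFiff x).1 hx).2 i' hi') h3
      simp [e, hjm i' hi'] at this
    have h3 := Submodule.finrank_lt_finrank_of_lt h1
    have h4 := Submodule.finrank_lt_finrank_of_lt h2
    lia
  refine ⟨i, ?_⟩
  ext x
  rw [hFiff]
  refine and_congr_right fun _ => ⟨fun h => h i hi, fun h i' hi' => huniq i' hi' ▸ h⟩

theorem encard_facets_stdSimplex_le (N : ℕ) :
    {F : Set (Fin N → ℝ) | IsFacet (stdSimplex ℝ (Fin N)) F}.encard ≤ N := by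
  have hsub : {F : Set (Fin N → ℝ) | IsFacet (stdSimplex ℝ (Fin N)) F} ⊆
      (fun i : Fin N => {x ∈ stdSimplex ℝ (Fin N) | x i = 0}) '' Set.univ := by
    intro F hF
    obtain ⟨i, hi⟩ := IsFacet.stdSimplex_eq hF
    exact ⟨i, trivial, hi.symm⟩
  calc _ ≤ _ := Set.encard_le_encard hsub
    _ ≤ _ := Set.encard_image_le _ _
    _ = N := by simp

/-- If finitely many points `s` of a convex hull `K` have the contraction of `K` towards `Z` by the
factor `c` in their convex hull, then `K` is approximated within `c` by the projection of a simplex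
with `s.card` vertices. -/
theorem exists_simplex_projection {E : Type*} [AddCommGroup E] [Module ℝ E] {X : Set E} {Z : E}
    {s : Finset E} {c : ℝ} (hc : 0 < c) (hs : (s : Set E) ⊆ convexHull ℝ X)
    (hX : ∀ x ∈ X, Z + c • (x - Z) ∈ convexHull ℝ (s : Set E)) :
    ∃ (P : Set (Fin s.card → ℝ)) (T : (Fin s.card → ℝ) →ₗ[ℝ] E), IsPolytope P ∧
      {F | IsFacet P F}.encard ≤ s.card ∧
      c • (T '' P - {Z}) ⊆ convexHull ℝ X - {Z} ∧ convexHull ℝ X - {Z} ⊆ T '' P - {Z} := by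
  classical
  let g : E →ᵃ[ℝ] E := AffineMap.homothety Z c⁻¹
  have hg (y : E) : g y = c⁻¹ • (y - Z) + Z := by simp [g, AffineMap.homothety_apply]
  let z : Fin s.card → E := fun i => s.equivFin.symm i
  -- A linear map is enough for the affine dilation, since coordinates sum to one on the simplex.
  let T : (Fin s.card → ℝ) →ₗ[ℝ] E := Fintype.linearCombination ℝ fun i => g (z i)
  have hT : T '' stdSimplex ℝ (Fin s.card) = g '' convexHull ℝ (s : Set E) := by
    rw [← convexHull_rangle_single_eq_stdSimplex, LinearMap.image_convexHull,
      AffineMap.image_convexHull]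
    congr 1
    ext y
    constructor
    · rintro ⟨_, ⟨i, rfl⟩, rfl⟩
      exact ⟨z i, (s.equivFin.symm i).2, by simp [T]⟩
    · rintro ⟨x, hx, rfl⟩
      exact ⟨_, ⟨s.equivFin ⟨x, hx⟩, rfl⟩, by simp [T, z]⟩
  refine ⟨stdSimplex ℝ (Fin s.card), T,
    ⟨Finset.univ.image fun i : Fin s.card => Pi.single i 1, ?_⟩, encard_facets_stdSimplex_le _,
    ?_, ?_⟩
  · rw [← convexHull_rangle_single_eq_stdSimplex]
    simp
  · rw [hT]
    rintro _ ⟨_, ⟨_, ⟨y, hy, rfl⟩, _, hZ, rfl⟩, rfl⟩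
    rw [Set.mem_singleton_iff] at hZ
    subst hZ
    refine ⟨y, convexHull_min hs (convex_convexHull ℝ X) hy, _, rfl, ?_⟩
    simp [hg, smul_smul, hc.ne']
  · rw [hT]
    refine Set.sub_subset_sub_right (convexHull_min (fun x hx => ?_) ?_)
    · exact ⟨_, hX x hx, by simp [hg, smul_smul, hc.ne']⟩
    · exact (convex_convexHull ℝ _).affine_image g

/-! ### Hamiltonian cycles and the barycenter -/

/-- Indexing by `ZMod n` turns rotation along the cycle into addition, wrap-around included. -/
theorem exists_cyclic_enumeration {n : ℕ} [NeZero n] {A : Matrix (Fin n) (Fin n) ℝ}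
    (hA : A ∈ hamiltonianCycleMatrices n) :
    ∃ f : ZMod n ≃ Fin n, ∀ a b, A (f a) (f b) = if b = a + 1 ∨ a = b + 1 then 1 else 0 := by
  obtain ⟨v, p, hp, rfl⟩ := hA
  have hlen : p.length = n := by simpa using hp.length_eq
  have hn : 0 < n := NeZero.pos n
  have hinj : Function.Injective fun a : ZMod n => p.getVert a.val := by
    intro a b hab
    have h1 := a.val_lt
    have h2 := b.val_lt
    exact ZMod.val_injective n (hp.isCycle.getVert_injOn' (by simp; lia) (by simp; lia) hab)
  have hcast (i : ℕ) (hi : i ≤ n) : p.getVert (i : ZMod n).val = p.getVert i := by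
    rw [ZMod.val_natCast]
    rcases hi.lt_or_eq with h | rfl
    · rw [Nat.mod_eq_of_lt h]
    · rw [Nat.mod_self, p.getVert_zero]
      exact (p.getVert_of_length_le hlen.le).symm
  let f : ZMod n ≃ Fin n := Equiv.ofBijective _
    ((Fintype.bijective_iff_injective_and_card _).2 ⟨hinj, by simp [ZMod.card]⟩)
  have hf (i : ℕ) (hi : i ≤ n) : p.getVert i = f (i : ZMod n) := (hcast i hi).symm
  refine ⟨f, fun a b => ?_⟩
  have key : s(f a, f b) ∈ p.edges ↔ b = a + 1 ∨ a = b + 1 := by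
    rw [SimpleGraph.Walk.mk_mem_edges_iff_exists, hlen]
    constructor
    · rintro ⟨i, hi, h⟩
      rw [hf i hi.le, hf (i + 1) hi, Sym2.eq_iff] at h
      rcases h with ⟨h1, h2⟩ | ⟨h1, h2⟩
      · left
        rw [← f.injective h1, ← f.injective h2]
        push_cast
        ring
      · right
        rw [← f.injective h1, ← f.injective h2]
        push_cast
        ring
    · rintro (rfl | rfl)
      · refine ⟨a.val, a.val_lt, ?_⟩
        rw [hf _ a.val_lt.le, hf _ a.val_lt]
        simp
      · refine ⟨b.val, b.val_lt, ?_⟩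
        rw [hf _ b.val_lt.le, hf _ b.val_lt, Sym2.eq_swap]
        simp
  simp [walkMatrix, key]

theorem submatrix_mem_hamiltonianCycleMatrices {n : ℕ} {A : Matrix (Fin n) (Fin n) ℝ}
    (hA : A ∈ hamiltonianCycleMatrices n) (σ : Equiv.Perm (Fin n)) :
    A.submatrix σ σ ∈ hamiltonianCycleMatrices n := by
  obtain ⟨v, p, hp, rfl⟩ := hA
  let g : (⊤ : SimpleGraph (Fin n)) →g (⊤ : SimpleGraph (Fin n)) :=
    (SimpleGraph.Iso.completeGraph σ.symm).toHom
  have hg : ⇑g = σ.symm := rfl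
  refine ⟨_, p.map g, hp.map σ.symm.bijective, ?_⟩
  ext i j
  have : s(i, j) ∈ (p.map g).edges ↔ s(σ i, σ j) ∈ p.edges := by
    rw [SimpleGraph.Walk.edges_map, hg]
    have h : s(i, j) = Sym2.map σ.symm s(σ i, σ j) := by simp
    rw [h]
    exact List.mem_map_of_injective (Sym2.map.injective σ.symm.injective)
  simp only [walkMatrix, Matrix.submatrix_apply, Matrix.of_apply, this]

/-- The linear relations which the matrices of Hamiltonian cycles satisfy. -/
structure IsTwoFactorPoint {n : ℕ} (A : Matrix (Fin n) (Fin n) ℝ) : Prop where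
  symm : ∀ u v, A u v = A v u
  diag : ∀ u, A u u = 0
  row_sum : ∀ u, ∑ v, A u v = 2

theorem isTwoFactorPoint_of_mem {n : ℕ} (hn : 3 ≤ n) {A : Matrix (Fin n) (Fin n) ℝ}
    (hA : A ∈ hamiltonianCycleMatrices n) : IsTwoFactorPoint A := by
  have : NeZero n := ⟨by lia⟩
  have : Fact (2 < n) := ⟨hn⟩
  obtain ⟨f, hf⟩ := exists_cyclic_enumeration hA
  have h1 : (1 : ZMod n) ≠ 0 := by
    have : Fact (1 < n) := ⟨by lia⟩
    exact one_ne_zero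
  have h2 : (-1 : ZMod n) ≠ 1 := ZMod.neg_one_ne_one
  refine ⟨fun u v => ?_, fun u => ?_, fun u => ?_⟩
  · obtain ⟨a, rfl⟩ := f.surjective u
    obtain ⟨b, rfl⟩ := f.surjective v
    simp only [hf, or_comm]
  · obtain ⟨a, rfl⟩ := f.surjective u
    simp [hf, h1]
  · obtain ⟨a, rfl⟩ := f.surjective u
    rw [← Equiv.sum_comp f]
    simp only [hf]
    rw [Finset.sum_ite, Finset.sum_const_zero, add_zero, Finset.sum_const]
    have : (Finset.univ.filter fun b : ZMod n => b = a + 1 ∨ a = b + 1) = {a + 1, a - 1} := by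
      ext b
      simp [eq_sub_iff_add_eq, eq_comm]
    rw [this, Finset.card_pair]
    · simp
    · intro h
      exact h2 (by linear_combination -h)

/-- Relabelling vertices permutes the Hamiltonian cycles, so all off-diagonal entries agree; the row
sum `2` then fixes their value. -/
theorem stspBarycenter_apply {n : ℕ} (hn : 3 ≤ n) (hX : (hamiltonianCycleMatrices n).Nonempty)
    (u v : Fin n) : stspBarycenter n u v = if u = v then 0 else 2 / (n - 1 : ℝ) := by
  classical
  set S := (hamiltonianCycleMatrices_finite n).toFinset with hS
  have hmem (A) : A ∈ S ↔ A ∈ hamiltonianCycleMatrices n := by simp [hS]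
  have hcard : (S.card : ℝ) ≠ 0 := by
    obtain ⟨A, hA⟩ := hX
    exact_mod_cast (Finset.card_pos.2 ⟨A, (hmem A).2 hA⟩).ne'
  have happ (u v : Fin n) : stspBarycenter n u v = (S.card : ℝ)⁻¹ * ∑ A ∈ S, A u v := by
    rw [stspBarycenter, Finset.centroid_def,
      S.affineCombination_eq_linear_combination _ _
        (S.sum_centroidWeights_eq_one_of_cast_card_ne_zero hcard)]
    simp [Matrix.sum_apply, Finset.mul_sum, hS]
  have hinv (σ : Equiv.Perm (Fin n)) (u v : Fin n) :
      stspBarycenter n (σ u) (σ v) = stspBarycenter n u v := by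
    rw [happ, happ]
    congr 1
    refine Finset.sum_bij' (fun A _ => A.submatrix σ σ) (fun A _ => A.submatrix σ.symm σ.symm)
      ?_ ?_ ?_ ?_ ?_
    · exact fun A hA => (hmem _).2 (submatrix_mem_hamiltonianCycleMatrices ((hmem A).1 hA) σ)
    · exact fun A hA => (hmem _).2 (submatrix_mem_hamiltonianCycleMatrices ((hmem A).1 hA) σ.symm)
    all_goals
      intro A hA
      try ext i j
      simp
  have hdiag (u : Fin n) : stspBarycenter n u u = 0 := by
    rw [happ, Finset.sum_eq_zero, mul_zero]
    exact fun A hA => (isTwoFactorPoint_of_mem hn ((hmem A).1 hA)).diag u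
  have hrow (u : Fin n) : ∑ v, stspBarycenter n u v = 2 := by
    simp only [happ]
    rw [← Finset.mul_sum, Finset.sum_comm, Finset.sum_congr rfl fun A hA =>
      (isTwoFactorPoint_of_mem hn ((hmem A).1 hA)).row_sum u]
    simp [hcard]
  split_ifs with huv
  · rw [huv, hdiag]
  have hconst (w : Fin n) (hw : w ≠ u) : stspBarycenter n u w = stspBarycenter n u v := by
    have := hinv (Equiv.swap v w) u v
    rwa [Equiv.swap_apply_of_ne_of_ne huv hw.symm, Equiv.swap_apply_left] at this
  have h := hrow u
  rw [← Finset.sum_erase_add _ _ (Finset.mem_univ u), hdiag, add_zero,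
    Finset.sum_congr rfl fun w hw => hconst w (Finset.ne_of_mem_erase hw), Finset.sum_const,
    Finset.card_erase_of_mem (Finset.mem_univ u), Finset.card_univ, Fintype.card_fin,
    nsmul_eq_mul, Nat.cast_sub (by lia)] at h
  have : (n : ℝ) - 1 ≠ 0 := by
    have : (3 : ℝ) ≤ n := by exact_mod_cast hn
    linarith
  rw [eq_div_iff this, ← h]
  push_cast
  ring

/-! ### Averages over groups of vertex permutations -/

section PermAverage

variable {n : ℕ}

open Classical in
/-- The average of a matrix over a group of simultaneous permutations of rows and columns. -/
noncomputable def permAverage (H : Subgroup (Equiv.Perm (Fin n))) (A : Matrix (Fin n) (Fin n) ℝ) :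
    Matrix (Fin n) (Fin n) ℝ :=
  ∑ h : H, (Fintype.card H : ℝ)⁻¹ • A.submatrix h h

variable {H : Subgroup (Equiv.Perm (Fin n))} {A : Matrix (Fin n) (Fin n) ℝ}

open Classical in
theorem permAverage_apply (u v : Fin n) :
    permAverage H A u v = (Fintype.card H : ℝ)⁻¹ * ∑ h : H, A (h.1 u) (h.1 v) := by
  simp [permAverage, Matrix.sum_apply, Finset.mul_sum]

open Classical in
theorem permAverage_mem (hA : A ∈ hamiltonianCycleMatrices n) : permAverage H A ∈ STSP n := by
  refine (convex_convexHull ℝ _).sum_mem (fun _ _ => by positivity) (by simp) fun h _ => ?_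
  exact subset_convexHull ℝ _ (submatrix_mem_hamiltonianCycleMatrices hA h.1)

open Classical in
theorem permAverage_perm_apply {σ : Equiv.Perm (Fin n)} (hσ : σ ∈ H) (u v : Fin n) :
    permAverage H A (σ u) (σ v) = permAverage H A u v := by
  rw [permAverage_apply, permAverage_apply]
  congr 1
  exact Equiv.sum_comp (Equiv.mulRight (⟨σ, hσ⟩ : H)) fun h : H => A (h.1 u) (h.1 v)

open Classical in
theorem permAverage_eq_of_fixed {u v : Fin n} (hu : ∀ h ∈ H, h u = u) (hv : ∀ h ∈ H, h v = v) :
    permAverage H A u v = A u v := by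
  rw [permAverage_apply, Finset.sum_congr rfl fun h _ => by rw [hu h.1 h.2, hv h.1 h.2]]
  simp

open Classical in
theorem permAverage_block_sum {W : Finset (Fin n)} (hW : ∀ h ∈ H, ∀ u, h u ∈ W ↔ u ∈ W) {s : ℝ}
    (hs : ∀ u ∈ W, ∑ v ∈ W, A u v = s) {u : Fin n} (hu : u ∈ W) :
    ∑ v ∈ W, permAverage H A u v = s := by
  have key (h : H) : ∑ v ∈ W, A (h.1 u) (h.1 v) = s := by
    rw [← hs _ ((hW h.1 h.2 u).2 hu)]
    exact Finset.sum_equiv h.1 (fun v => (hW h.1 h.2 v).symm) fun _ _ => rfl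
  simp only [permAverage_apply]
  rw [← Finset.mul_sum, Finset.sum_comm, Finset.sum_congr rfl fun h _ => key h]
  simp

theorem IsTwoFactorPoint.permAverage (hA : IsTwoFactorPoint A) :
    IsTwoFactorPoint (permAverage H A) where
  symm u v := by simp only [permAverage_apply, hA.symm]
  diag u := by simp [permAverage_apply, hA.diag]
  row_sum u := permAverage_block_sum (W := Finset.univ) (by simp)
    (fun u _ => hA.row_sum u) (Finset.mem_univ u)

end PermAverage

/-! ### Points of the polytope attached to matchings -/

section MatchingPoint

variable {n : ℕ} {A : Matrix (Fin n) (Fin n) ℝ} {W : Finset (Fin n)}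

/-- By swap invariance, row `u` is constant outside `W`, where it carries the remaining mass `2 -
1`. -/
theorem IsTwoFactorPoint.apply_cross (hA : IsTwoFactorPoint A)
    (hswap : ∀ u ∉ W, ∀ v ∉ W, ∀ a b, A (Equiv.swap u v a) (Equiv.swap u v b) = A a b)
    (hW : ∀ u ∈ W, ∑ v ∈ W, A u v = 1) {u v : Fin n} (hu : u ∈ W) (hv : v ∉ W) :
    A u v * (n - W.card) = 1 := by
  have h := hA.row_sum u
  rw [← Finset.sum_add_sum_compl W, hW u hu, Finset.sum_congr rfl (g := fun _ => A u v),
    Finset.sum_const, Finset.card_compl, Fintype.card_fin, nsmul_eq_mul,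
    Nat.cast_sub (by simpa using W.card_le_univ)] at h
  · linarith
  · intro w hw
    rw [Finset.mem_compl] at hw
    have := hswap v hv w hw u v
    rwa [Equiv.swap_apply_left, Equiv.swap_apply_of_ne_of_ne (ne_of_mem_of_not_mem hu hv)
      (ne_of_mem_of_not_mem hu hw)] at this

theorem IsTwoFactorPoint.apply_outer (hA : IsTwoFactorPoint A)
    (hswap : ∀ u ∉ W, ∀ v ∉ W, ∀ a b, A (Equiv.swap u v a) (Equiv.swap u v b) = A a b)
    (hW : ∀ u ∈ W, ∑ v ∈ W, A u v = 1) {u v : Fin n} (hu : u ∉ W) (hv : v ∉ W) (huv : u ≠ v) :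
    W.card + A u v * ((n - W.card) * (n - W.card - 1)) = 2 * (n - W.card) := by
  have hr : ((n : ℝ) - W.card) ≠ 0 := by
    have h := Finset.card_lt_univ_of_notMem hu
    rw [Fintype.card_fin] at h
    exact sub_ne_zero.2 (by exact_mod_cast h.ne')
  have hcross : ∀ w ∈ W, A u w = (n - W.card : ℝ)⁻¹ := fun w hw => by
    rw [hA.symm, eq_inv_of_mul_eq_one_left (hA.apply_cross hswap hW hw hu)]
  have h := hA.row_sum u
  have huc : u ∈ Wᶜ := Finset.mem_compl.2 hu
  have hpos : 1 ≤ Wᶜ.card := Finset.card_pos.2 ⟨u, huc⟩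
  have hout : ∀ w ∈ Wᶜ.erase u, A u w = A u v := by
    intro w hw
    rw [Finset.mem_erase, Finset.mem_compl] at hw
    have := hswap v hv w hw.2 u v
    rwa [Equiv.swap_apply_left, Equiv.swap_apply_of_ne_of_ne huv hw.1.symm] at this
  rw [← Finset.sum_add_sum_compl W, Finset.sum_congr rfl hcross,
    ← Finset.sum_erase_add _ _ huc, hA.diag, add_zero, Finset.sum_congr rfl hout,
    Finset.sum_const, Finset.sum_const, Finset.card_erase_of_mem huc, nsmul_eq_mul, nsmul_eq_mul,
    Nat.cast_sub hpos, Finset.card_compl, Fintype.card_fin,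
    Nat.cast_sub (by simpa using W.card_le_univ)] at h
  push_cast at h
  field_simp at h
  linarith

/-- The weight of the average over all permutations of the endpoints of a matching of size `k`
in `matchingPoint`. -/
noncomputable def mixWeight (n k : ℕ) : ℝ :=
  (2 * k - 1) * (2 * k - 2) / ((n - 2 * k) * (n - 2 * k - 1))

/-- The entries of `matchingPoint` outside the endpoints of the matching. -/
noncomputable def outerWeight (n k : ℕ) : ℝ :=
  2 / (n - 2 * k) - (2 * k - 2) / ((n - 2 * k) * (n - 2 * k - 1))

/-- For a matching with `k` edges, vertex set `W` and adjacency matrix `S`, the barycenter of the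
Symmetric Traveling Salesman Polytope moved in the direction of `S`. -/
noncomputable def matchingPoint (k : ℕ) (W : Finset (Fin n)) (S : Matrix (Fin n) (Fin n) ℝ) :
    Matrix (Fin n) (Fin n) ℝ :=
  Matrix.of fun u v => if u = v then 0 else
    (1 - mixWeight n k) * S u v + outerWeight n k +
      (1 / (n - 2 * k) - outerWeight n k) *
        ((if u ∈ W then 1 else 0) + (if v ∈ W then 1 else 0))

/-- The point is a convex combination of the averages of `A` over the pointwise and the setwise
stabilizer of `W`. Row sums determine both: they agree off `W × W`, while inside `W` the first is
the matching and the second is the constant `1 / (2k - 1)` off the diagonal. -/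
theorem matchingPoint_mem {k : ℕ} (hk : 1 ≤ k) (hkn : 3 * k ≤ n)
    (hA : A ∈ hamiltonianCycleMatrices n)
    (hcard : W.card = 2 * k) (hW : ∀ u ∈ W, ∑ v ∈ W, A u v = 1)
    (h0 : 0 ≤ mixWeight n k) (h1 : mixWeight n k ≤ 1) :
    matchingPoint k W (Matrix.of fun u v => if u ∈ W ∧ v ∈ W then A u v else 0) ∈ STSP n := by
  have hA' := isTwoFactorPoint_of_mem (by lia) hA
  let H₁ : Subgroup (Equiv.Perm (Fin n)) := fixingSubgroup (Equiv.Perm (Fin n)) (W : Set (Fin n))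
  let H₂ : Subgroup (Equiv.Perm (Fin n)) :=
    { carrier := {σ | ∀ u, σ u ∈ W ↔ u ∈ W}
      mul_mem' := fun {σ τ} hσ hτ u => (hσ (τ u)).trans (hτ u)
      one_mem' := fun u => Iff.rfl
      inv_mem' := fun {σ} hσ u => by simpa using (hσ (σ⁻¹ u)).symm }
  have hH₁ (σ : Equiv.Perm (Fin n)) : σ ∈ H₁ ↔ ∀ u ∈ W, σ u = u := by
    simp [H₁, mem_fixingSubgroup_iff]
  have hH₂ (σ : Equiv.Perm (Fin n)) : σ ∈ H₂ ↔ ∀ u, σ u ∈ W ↔ u ∈ W := Iff.rfl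
  have hle : H₁ ≤ H₂ := by
    intro σ hσ u
    refine ⟨fun h => ?_, fun h => ((hH₁ σ).1 hσ u h).symm ▸ h⟩
    rwa [← σ.injective ((hH₁ σ).1 hσ _ h)]
  have hs₁ : ∀ u ∉ W, ∀ v ∉ W, Equiv.swap u v ∈ H₁ := fun u hu v hv => (hH₁ _).2 fun w hw =>
    Equiv.swap_apply_of_ne_of_ne (ne_of_mem_of_not_mem hw hu) (ne_of_mem_of_not_mem hw hv)
  have hs₂ : ∀ u ∈ W, ∀ v ∈ W, Equiv.swap u v ∈ H₂ := by
    intro u hu v hv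
    rw [hH₂]
    intro w
    by_cases h1 : w = u
    · simp [h1, hu, hv]
    by_cases h2 : w = v
    · simp [h2, hu, hv]
    rw [Equiv.swap_apply_of_ne_of_ne h1 h2]
  set y₁ := permAverage H₁ A with hy₁
  set y₂ := permAverage H₂ A with hy₂
  have hy₁A : ∀ u ∈ W, ∀ v ∈ W, y₁ u v = A u v := fun u hu v hv =>
    permAverage_eq_of_fixed (fun h hh => (hH₁ h).1 hh u hu) fun h hh => (hH₁ h).1 hh v hv
  have hW₁ : ∀ u ∈ W, ∑ v ∈ W, y₁ u v = 1 := fun u hu =>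
    permAverage_block_sum (fun h hh => (hH₂ h).1 (hle hh)) hW hu
  have hW₂ : ∀ u ∈ W, ∑ v ∈ W, y₂ u v = 1 := fun u hu =>
    permAverage_block_sum (fun h hh => (hH₂ h).1 hh) hW hu
  have t₁ : IsTwoFactorPoint y₁ := hA'.permAverage
  have t₂ : IsTwoFactorPoint y₂ := hA'.permAverage
  have hsw₁ : ∀ u ∉ W, ∀ v ∉ W, ∀ a b, y₁ (Equiv.swap u v a) (Equiv.swap u v b) = y₁ a b :=
    fun u hu v hv => permAverage_perm_apply (hs₁ u hu v hv)
  have hsw₂ : ∀ u ∉ W, ∀ v ∉ W, ∀ a b, y₂ (Equiv.swap u v a) (Equiv.swap u v b) = y₂ a b :=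
    fun u hu v hv => permAverage_perm_apply (hle (hs₁ u hu v hv))
  have hk' : (1 : ℝ) ≤ k := by exact_mod_cast hk
  have hinner : ∀ u ∈ W, ∀ v ∈ W, u ≠ v → y₂ u v * (2 * k - 1) = 1 := by
    intro u hu v hv huv
    have h := hW₂ u hu
    rw [← Finset.sum_erase_add _ _ hu, t₂.diag, add_zero,
      Finset.sum_congr rfl (g := fun _ => y₂ u v), Finset.sum_const, Finset.card_erase_of_mem hu,
      hcard, nsmul_eq_mul, Nat.cast_sub (by lia)] at h
    · push_cast at h
      linarith
    · intro w hw
      rw [Finset.mem_erase] at hw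
      have : y₂ _ _ = _ := permAverage_perm_apply (A := A) (hs₂ v hv w hw.2) u v
      rwa [Equiv.swap_apply_left, Equiv.swap_apply_of_ne_of_ne huv hw.1.symm] at this
  have hcard' : (W.card : ℝ) = 2 * k := by rw [hcard]; push_cast; ring
  have hr : (n : ℝ) - 2 * k ≠ 0 := by
    have : (3 * k : ℝ) ≤ n := by exact_mod_cast hkn
    linarith
  have hcross {y : Matrix (Fin n) (Fin n) ℝ} (t : IsTwoFactorPoint y)
      (hs : ∀ u ∉ W, ∀ v ∉ W, ∀ a b, y (Equiv.swap u v a) (Equiv.swap u v b) = y a b)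
      (hw : ∀ u ∈ W, ∑ v ∈ W, y u v = 1) {u v} (hu : u ∈ W) (hv : v ∉ W) :
      y u v = 1 / (n - 2 * k) := by
    have := t.apply_cross hs hw hu hv
    rw [hcard'] at this
    rwa [eq_div_iff hr]
  have houter {y : Matrix (Fin n) (Fin n) ℝ} (t : IsTwoFactorPoint y)
      (hs : ∀ u ∉ W, ∀ v ∉ W, ∀ a b, y (Equiv.swap u v a) (Equiv.swap u v b) = y a b)
      (hw : ∀ u ∈ W, ∑ v ∈ W, y u v = 1) {u v} (hu : u ∉ W) (hv : v ∉ W) (huv : u ≠ v) :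
      y u v = outerWeight n k := by
    have := t.apply_outer hs hw hu hv huv
    rw [hcard'] at this
    have hr1 : (n : ℝ) - 2 * k - 1 ≠ 0 := by
      have h2 : 2 ≤ Wᶜ.card := by
        rw [← Finset.card_pair huv]
        refine Finset.card_le_card fun w hw => ?_
        simp only [Finset.mem_insert, Finset.mem_singleton] at hw
        rcases hw with rfl | rfl <;> simpa
      rw [Finset.card_compl, hcard, Fintype.card_fin] at h2
      have : (2 * k + 2 : ℝ) ≤ n := by exact_mod_cast (by lia : 2 * k + 2 ≤ n)
      linarith
    rw [outerWeight]
    field_simp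
    linarith
  have hz : matchingPoint k W (Matrix.of fun u v => if u ∈ W ∧ v ∈ W then A u v else 0) =
      (1 - mixWeight n k) • y₁ + mixWeight n k • y₂ := by
    ext u v
    simp only [matchingPoint, Matrix.of_apply, Matrix.add_apply, Matrix.smul_apply, smul_eq_mul]
    by_cases huv : u = v
    · simp [huv, t₁.diag, t₂.diag]
    by_cases hu : u ∈ W <;> by_cases hv : v ∈ W <;> simp only [huv, hu, hv, and_true, and_false,
      if_true, if_false]
    · have h2 : y₂ u v = 1 / (2 * k - 1) := by
        rw [eq_div_iff (by linarith)]
        exact hinner u hu v hv huv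
      -- The right side is `2 / (n - 2k) - outerWeight n k`; this equation dictates the value of
      -- `mixWeight` and removes the product of the two indicators.
      have h3 : mixWeight n k * (1 / (2 * k - 1)) =
          (2 * k - 2) / ((n - 2 * k) * (n - 2 * k - 1)) := by
        have : (2 * k - 1 : ℝ) ≠ 0 := by linarith
        rw [mixWeight]
        field_simp
      rw [hy₁A u hu v hv, h2, h3, outerWeight]
      ring
    · rw [hcross t₁ hsw₁ hW₁ hu hv, hcross t₂ hsw₂ hW₂ hu hv]
      ring
    · rw [t₁.symm, t₂.symm, hcross t₁ hsw₁ hW₁ hv hu, hcross t₂ hsw₂ hW₂ hv hu]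
      ring
    · rw [houter t₁ hsw₁ hW₁ hu hv huv, houter t₂ hsw₂ hW₂ hu hv huv]
      ring
  rw [hz]
  exact convex_convexHull ℝ _ (permAverage_mem hA) (permAverage_mem hA) (by linarith) h0 (by ring)

end MatchingPoint

/-! ### Rotating a matching along a cycle -/

section Windows

variable {n k : ℕ}

/-- The tails of the edges `{0, 1}, {3, 4}, {6, 7}, …` in the cycle `ZMod n`. -/
def matchingTails (n k : ℕ) : Finset (ZMod n) :=
  Finset.univ.image fun i : Fin k => ((3 * i.1 : ℕ) : ZMod n)

theorem mem_matchingTails {t : ZMod n} :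
    t ∈ matchingTails n k ↔ ∃ i : Fin k, ((3 * i.1 : ℕ) : ZMod n) = t := by
  simp [matchingTails]

theorem natCast_zmod_inj {a b : ℕ} (ha : a < n) (hb : b < n) (h : (a : ZMod n) = b) : a = b := by
  rwa [ZMod.natCast_eq_natCast_iff', Nat.mod_eq_of_lt ha, Nat.mod_eq_of_lt hb] at h

theorem card_matchingTails (hkn : 3 * k ≤ n) : (matchingTails n k).card = k := by
  rw [matchingTails, Finset.card_image_of_injective, Finset.card_univ, Fintype.card_fin]
  intro i j h
  have := natCast_zmod_inj (by lia) (by lia) h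
  ext
  lia

/-- Offset `1` makes the chosen edges disjoint; offset `2` ensures that no cycle edge joins two of
them. The bound `3k ≤ n` secures both across the wrap-around. -/
theorem add_notMem_matchingTails (hkn : 3 * k ≤ n) {t : ZMod n} (ht : t ∈ matchingTails n k)
    {d : ℕ} (hd : d = 1 ∨ d = 2) : t + d ∉ matchingTails n k := by
  rw [mem_matchingTails] at ht ⊢
  obtain ⟨i, rfl⟩ := ht
  rintro ⟨j, hj⟩
  rw [← Nat.cast_add] at hj
  have := natCast_zmod_inj (by lia) (by lia) hj
  lia

/-- The endpoints of a tuple of edges. -/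
def endpoints (w : Fin k → Fin n × Fin n) : Finset (Fin n) :=
  Finset.univ.image (fun i => (w i).1) ∪ Finset.univ.image fun i => (w i).2

open Classical in
/-- The adjacency matrix of a tuple of edges. -/
noncomputable def edgesMatrix (w : Fin k → Fin n × Fin n) : Matrix (Fin n) (Fin n) ℝ :=
  Matrix.of fun u v => if ∃ i, w i = (u, v) ∨ w i = (v, u) then 1 else 0

/-- Every third edge of the cycle `f`, from `f j` on. -/
def cycleWindow (k : ℕ) (f : ZMod n ≃ Fin n) (j : ZMod n) (i : Fin k) : Fin n × Fin n :=
  (f (j + (3 * i.1 : ℕ)), f (j + (3 * i.1 : ℕ) + 1))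

variable {f : ZMod n ≃ Fin n}

theorem mem_endpoints_cycleWindow {a j : ZMod n} :
    f a ∈ endpoints (cycleWindow k f j) ↔
      a - j ∈ matchingTails n k ∨ a - j - 1 ∈ matchingTails n k := by
  simp only [endpoints, cycleWindow, Finset.mem_union, Finset.mem_image, Finset.mem_univ,
    true_and, f.injective.eq_iff, mem_matchingTails]
  refine or_congr (exists_congr fun i => ?_) (exists_congr fun i => ?_)
  · rw [eq_sub_iff_add_eq, add_comm]
  · rw [sub_sub, eq_sub_iff_add_eq]
    ring_nf

open Classical in
theorem edgesMatrix_cycleWindow {a b j : ZMod n} :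
    edgesMatrix (cycleWindow k f j) (f a) (f b) =
      if (a - j ∈ matchingTails n k ∧ b = a + 1) ∨ (b - j ∈ matchingTails n k ∧ a = b + 1)
      then 1 else 0 := by
  have h (a b : ZMod n) : (∃ i, cycleWindow k f j i = (f a, f b)) ↔
      a - j ∈ matchingTails n k ∧ b = a + 1 := by
    simp only [cycleWindow, Prod.mk.injEq, f.injective.eq_iff, mem_matchingTails]
    constructor
    · rintro ⟨i, rfl, rfl⟩
      exact ⟨⟨i, by ring⟩, rfl⟩
    · rintro ⟨⟨i, hi⟩, rfl⟩
      have : j + ((3 * i.1 : ℕ) : ZMod n) = a := by rw [hi]; ring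
      exact ⟨i, this, by rw [this]⟩
  simp only [edgesMatrix, Matrix.of_apply, exists_or, h]

variable {A : Matrix (Fin n) (Fin n) ℝ}

theorem card_endpoints_cycleWindow (hkn : 3 * k ≤ n) (j : ZMod n) :
    (endpoints (cycleWindow k f j)).card = 2 * k := by
  have : endpoints (cycleWindow k f j) =
      ((matchingTails n k).image fun t => f (t + j)) ∪
        (matchingTails n k).image fun t => f (t + j + 1) := by
    ext u
    obtain ⟨a, rfl⟩ := f.surjective u
    simp only [mem_endpoints_cycleWindow, Finset.mem_union, Finset.mem_image, f.injective.eq_iff]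
    refine or_congr ⟨fun h => ⟨_, h, by ring⟩, ?_⟩ ⟨fun h => ⟨_, h, by ring⟩, ?_⟩
    · rintro ⟨t, ht, rfl⟩
      simpa
    · rintro ⟨t, ht, rfl⟩
      convert ht using 1
      ring
  rw [this, Finset.card_union_of_disjoint, Finset.card_image_of_injective,
    Finset.card_image_of_injective, card_matchingTails hkn, two_mul]
  · intro a b h
    simpa using h
  · intro a b h
    simpa using h
  · rw [Finset.disjoint_left]
    rintro u h1 h2
    rw [Finset.mem_image] at h1 h2
    obtain ⟨a, ha, rfl⟩ := h1
    obtain ⟨b, hb, h⟩ := h2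
    rw [f.injective.eq_iff] at h
    have hab : a = b + (1 : ℕ) := by push_cast; linear_combination -h
    exact add_notMem_matchingTails hkn hb (Or.inl rfl) (hab ▸ ha)

/-- The spacing of three makes the matching an induced subgraph of the cycle, as `matchingPoint_mem`
needs. -/
theorem edgesMatrix_cycleWindow_eq (hkn : 3 * k ≤ n)
    (hf : ∀ a b, A (f a) (f b) = if b = a + 1 ∨ a = b + 1 then 1 else 0) (j : ZMod n) :
    edgesMatrix (cycleWindow k f j) =
    Matrix.of fun u v => if u ∈ endpoints (cycleWindow k f j) ∧ v ∈ endpoints (cycleWindow k f j)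
      then A u v else 0 := by
  classical
  have key (a : ZMod n) : a - j ∈ matchingTails n k ↔
      f a ∈ endpoints (cycleWindow k f j) ∧ f (a + 1) ∈ endpoints (cycleWindow k f j) := by
    rw [mem_endpoints_cycleWindow, mem_endpoints_cycleWindow]
    have e : a + 1 - j - 1 = a - j := by ring
    rw [e]
    refine ⟨fun h => ⟨Or.inl h, Or.inr h⟩, ?_⟩
    rintro ⟨h | h, h' | h'⟩ <;> try assumption
    have := add_notMem_matchingTails hkn h (Or.inr rfl)
    refine absurd h' ?_
    convert this using 2
    push_cast
    ring
  ext u v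
  obtain ⟨a, rfl⟩ := f.surjective u
  obtain ⟨b, rfl⟩ := f.surjective v
  rw [edgesMatrix_cycleWindow, Matrix.of_apply, hf, ← ite_and]
  refine if_congr ?_ rfl rfl
  rw [key, key]
  constructor
  · rintro (⟨h, rfl⟩ | ⟨h, rfl⟩)
    · exact ⟨h, Or.inl rfl⟩
    · exact ⟨h.symm, Or.inr rfl⟩
  · rintro ⟨h, rfl | rfl⟩
    · exact Or.inl ⟨h, rfl⟩
    · exact Or.inr ⟨h.symm, rfl⟩

theorem sum_endpoints_cycleWindow [NeZero n] (hkn : 3 * k ≤ n)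
    (hf : ∀ a b, A (f a) (f b) = if b = a + 1 ∨ a = b + 1 then 1 else 0) (j : ZMod n) {u : Fin n}
    (hu : u ∈ endpoints (cycleWindow k f j)) :
    ∑ v ∈ endpoints (cycleWindow k f j), A u v = 1 := by
  classical
  have h1 : ∑ v ∈ endpoints (cycleWindow k f j), A u v =
      ∑ v, edgesMatrix (cycleWindow k f j) u v := by
    rw [edgesMatrix_cycleWindow_eq hkn hf]
    simp [hu]
  obtain ⟨a, rfl⟩ := f.surjective u
  rw [h1, ← Equiv.sum_comp f]
  simp only [edgesMatrix_cycleWindow]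
  rw [mem_endpoints_cycleWindow] at hu
  rcases hu with h | h
  · rw [Finset.sum_eq_single (a + 1)]
    · simp [h]
    · rintro b - hb
      refine if_neg ?_
      rintro (⟨-, h2⟩ | ⟨h2, rfl⟩)
      · exact hb h2
      · refine add_notMem_matchingTails hkn h2 (Or.inl rfl) ?_
        convert h using 1
        push_cast
        ring
    · simp
  · have h' : a - 1 - j ∈ matchingTails n k := by
      convert h using 1
      ring
    rw [Finset.sum_eq_single (a - 1)]
    · simp [h']
    · rintro b - hb
      refine if_neg ?_
      rintro (⟨h2, -⟩ | ⟨-, h2⟩)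
      · refine add_notMem_matchingTails hkn h (Or.inl rfl) ?_
        convert h2 using 1
        push_cast
        ring
      · exact hb (by rw [h2]; ring)
    · simp

theorem card_shift_matchingTails [NeZero n] (hkn : 3 * k ≤ n) (a : ZMod n) :
    (Finset.univ.filter fun j => a - j ∈ matchingTails n k).card = k := by
  refine Eq.trans ?_ (card_matchingTails hkn)
  refine Finset.card_bij' (fun j _ => a - j) (fun t _ => a - t) ?_ ?_ ?_ ?_ <;> simp

theorem sum_mem_endpoints_cycleWindow [NeZero n] (hkn : 3 * k ≤ n) (u : Fin n) :
    ∑ j, (if u ∈ endpoints (cycleWindow k f j) then (1 : ℝ) else 0) = 2 * k := by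
  classical
  simp_rw [Finset.sum_boole]
  obtain ⟨a, rfl⟩ := f.surjective u
  simp only [mem_endpoints_cycleWindow]
  rw [Finset.filter_or, Finset.card_union_of_disjoint, card_shift_matchingTails hkn]
  · have : ∀ j, a - j - 1 = a - 1 - j := fun j => by ring
    simp only [this]
    rw [card_shift_matchingTails hkn]
    push_cast
    ring
  · rw [Finset.disjoint_filter]
    rintro j - h1 h2
    refine add_notMem_matchingTails hkn h2 (Or.inl rfl) ?_
    convert h1 using 1
    push_cast
    ring

theorem sum_edgesMatrix_cycleWindow [NeZero n] (hkn : 3 * k ≤ n)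
    (hf : ∀ a b, A (f a) (f b) = if b = a + 1 ∨ a = b + 1 then 1 else 0) (hn : 3 ≤ n) (u v : Fin n) :
    ∑ j, edgesMatrix (cycleWindow k f j) u v = k * A u v := by
  classical
  obtain ⟨a, rfl⟩ := f.surjective u
  obtain ⟨b, rfl⟩ := f.surjective v
  simp only [edgesMatrix_cycleWindow, hf]
  have : Fact (2 < n) := ⟨hn⟩
  have h2 : (-1 : ZMod n) ≠ 1 := ZMod.neg_one_ne_one
  rw [Finset.sum_boole]
  by_cases h : b = a + 1
  · have h' : a ≠ b + 1 := fun h' => h2 (by linear_combination h + h')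
    simp only [h, h ▸ h', and_true, and_false, or_false, if_true, card_shift_matchingTails hkn,
      mul_one]
  · by_cases h' : a = b + 1
    · simp only [h', and_true, or_true, if_true]
      simp [← h', h, card_shift_matchingTails hkn]
    · simp [h, h']

end Windows

/-! ### Numerical estimates and conclusion -/

theorem three_mul_le_of_pow_three_le {n k : ℕ} (hn : 3 ≤ n) (hkn : k ^ 3 ≤ n) : 3 * k ≤ n := by
  rcases Nat.lt_or_ge k 2 with h | h
  · lia
  · nlinarith [Nat.mul_le_mul h h, Nat.zero_le k]

theorem mixWeight_bounds {n k : ℕ} (hn : 3 ≤ n) (hk : 1 ≤ k) (hkn : k ^ 3 ≤ n) :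
    0 ≤ mixWeight n k ∧ mixWeight n k < 1 ∧ mixWeight n k * k ≤ 1 := by
  rcases hk.eq_or_lt with rfl | hk
  · simp [mixWeight]
  -- With `k = 2 + m` and `n = k ^ 3 + d`, the claims become inequalities in nonnegative variables;
  -- `r` below is `n - 2k`.
  obtain ⟨m, rfl⟩ := Nat.exists_eq_add_of_le hk
  obtain ⟨d, rfl⟩ := Nat.exists_eq_add_of_le hkn
  rw [mixWeight]
  push_cast
  set x : ℝ := (m : ℝ) with hx
  set y : ℝ := (d : ℝ) with hy
  have hx0 : 0 ≤ x := Nat.cast_nonneg m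
  have hy0 : 0 ≤ y := Nat.cast_nonneg d
  set r : ℝ := x ^ 3 + 6 * x ^ 2 + 10 * x + 4 + y with hr
  have e1 : (2 + x) ^ 3 + y - 2 * (2 + x) = r := by rw [hr]; ring
  have e2 : (2 * (2 + x) - 1) * (2 * (2 + x) - 2) = (2 * x + 3) * (2 * x + 2) := by ring
  rw [e1, e2]
  have h1 : 0 < r := by positivity
  have h3 : 10 * x + 4 ≤ r := by rw [hr]; nlinarith [pow_nonneg hx0 3, sq_nonneg x]
  have h2 : 0 < r - 1 := by linarith
  have h4 : (2 * x + 3) * (2 * x + 2) * (2 + x) ≤ r * (r - 1) := by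
    have h5 : x ^ 3 + 6 * x ^ 2 + 10 * x + 4 ≤ r := by rw [hr]; linarith
    have h6 : (3 : ℝ) ≤ r - 1 := by linarith
    have h7 : (x ^ 3 + 6 * x ^ 2 + 10 * x + 4) * (10 * x + 3) ≤ r * (r - 1) :=
      mul_le_mul h5 (by linarith) (by positivity) h1.le
    refine le_trans ?_ h7
    have : 0 ≤ x ^ 2 := sq_nonneg x
    have : 0 ≤ x ^ 3 := pow_nonneg hx0 3
    have : 0 ≤ x ^ 4 := pow_nonneg hx0 4
    nlinarith
  have h8 : 0 < r * (r - 1) := mul_pos h1 h2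
  have h9 : 0 < (2 * x + 3) * (2 * x + 2) := by positivity
  refine ⟨by positivity, ?_, ?_⟩
  · rw [div_lt_one h8]
    nlinarith
  · rw [div_mul_eq_mul_div, div_le_one h8]
    exact h4

theorem outerWeight_identity {n k : ℕ} (hn : 3 ≤ n) (hk : 1 ≤ k) (hkn : 3 * k ≤ n) :
    outerWeight n k + (1 / (n - 2 * k) - outerWeight n k) * (2 * (2 * k) / n) =
      (1 - (1 - mixWeight n k) * k / n) * (2 / (n - 1)) := by
  have hn0 : (n : ℝ) ≠ 0 := by positivity
  rw [outerWeight, mixWeight]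
  -- The factor `n - 2k - 1` vanishes only for `n = 3`, `k = 1`, where division by zero yields `0`
  -- and the identity still holds.
  rcases (show n = 2 * k + 1 ∨ 2 * k + 2 ≤ n by lia) with h | h
  · obtain rfl : k = 1 := by lia
    obtain rfl : n = 3 := by lia
    norm_num
  · have h1 : (2 * k + 2 : ℝ) ≤ n := by exact_mod_cast h
    have h3 : (n : ℝ) - 2 * k ≠ 0 := by linarith
    have h4 : (n : ℝ) - 2 * k - 1 ≠ 0 := by linarith
    have h5 : (n : ℝ) - 1 ≠ 0 := by
      have : (1 : ℝ) ≤ k := by exact_mod_cast hk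
      linarith
    field_simp
    ring

theorem sum_matchingPoint_cycleWindow {n k : ℕ} [NeZero n] (hn : 3 ≤ n) (hk : 1 ≤ k)
    (hkn : 3 * k ≤ n) {A : Matrix (Fin n) (Fin n) ℝ} (hA : A ∈ hamiltonianCycleMatrices n)
    {f : ZMod n ≃ Fin n} (hf : ∀ a b, A (f a) (f b) = if b = a + 1 ∨ a = b + 1 then 1 else 0) :
    ∑ j, (n : ℝ)⁻¹ • matchingPoint k (endpoints (cycleWindow k f j))
        (edgesMatrix (cycleWindow k f j)) =
      stspBarycenter n + ((1 - mixWeight n k) * k / n) • (A - stspBarycenter n) := by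
  have hn0 : (n : ℝ) ≠ 0 := by positivity
  ext u v
  simp only [Matrix.sum_apply, Matrix.smul_apply, Matrix.add_apply, Matrix.sub_apply, smul_eq_mul,
    matchingPoint, Matrix.of_apply, stspBarycenter_apply hn ⟨A, hA⟩]
  by_cases huv : u = v
  · simp [huv, (isTwoFactorPoint_of_mem hn hA).diag]
  simp only [huv, if_false]
  rw [← Finset.mul_sum, Finset.sum_add_distrib, Finset.sum_add_distrib, ← Finset.mul_sum,
    ← Finset.mul_sum, Finset.sum_add_distrib, sum_mem_endpoints_cycleWindow hkn,
    sum_mem_endpoints_cycleWindow hkn, sum_edgesMatrix_cycleWindow hkn hf hn, Finset.sum_const,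
    Finset.card_univ, ZMod.card, nsmul_eq_mul]
  have h := outerWeight_identity hn hk hkn
  have e : (n : ℝ)⁻¹ * ((1 - mixWeight n k) * (k * A u v) + n * outerWeight n k +
      (1 / (n - 2 * k) - outerWeight n k) * (2 * k + 2 * k)) =
      (1 - mixWeight n k) * k / n * A u v + (outerWeight n k +
        (1 / (n - 2 * k) - outerWeight n k) * (2 * (2 * k) / n)) := by
    generalize (1 / (n - 2 * k) - outerWeight n k : ℝ) = b
    field_simp
    ring
  rw [e, h]
  ring

theorem theorem2 :
    ∃ C D : ℕ, ∀ n k : ℕ, 3 ≤ n → 1 ≤ k → (k : ℝ) ≤ (n : ℝ) ^ ((1 : ℝ) / 3) →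
      ∃ (N : ℕ) (P : Set (Fin N → ℝ)) (T : (Fin N → ℝ) →ₗ[ℝ] Matrix (Fin n) (Fin n) ℝ) (c : ℝ),
        IsPolytope P ∧
        {F : Set (Fin N → ℝ) | IsFacet P F}.encard ≤ ((C * n ^ (4 * k) : ℕ) : ℕ∞) ∧
        0 < c ∧
        |c - (k : ℝ) / (n : ℝ)| ≤ (D : ℝ) / (n : ℝ) ∧
        c • (T '' P - {stspBarycenter n}) ⊆ STSP n - {stspBarycenter n} ∧
        STSP n - {stspBarycenter n} ⊆ T '' P - {stspBarycenter n} := by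
  classical
  refine ⟨1, 1, fun n k hn hk hkn => ?_⟩
  have : NeZero n := ⟨by lia⟩
  have hn0 : (0 : ℝ) < n := by positivity
  have hk0 : (0 : ℝ) < k := by positivity
  have hcube : k ^ 3 ≤ n := by
    have h : (k : ℝ) ^ 3 ≤ ((n : ℝ) ^ ((1 : ℝ) / 3)) ^ 3 := pow_le_pow_left₀ hk0.le hkn 3
    rw [← Real.rpow_natCast ((n : ℝ) ^ ((1 : ℝ) / 3)), ← Real.rpow_mul hn0.le] at h
    norm_num at h
    exact_mod_cast h
  have h3 := three_mul_le_of_pow_three_le hn hcube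
  obtain ⟨h0, h1, h2⟩ := mixWeight_bounds hn hk hcube
  set c : ℝ := (1 - mixWeight n k) * k / n with hc
  have hc0 : 0 < c := by
    have : 0 < 1 - mixWeight n k := by linarith
    positivity
  let pt : (Fin k → Fin n × Fin n) → Matrix (Fin n) (Fin n) ℝ := fun w =>
    matchingPoint k (endpoints w) (edgesMatrix w)
  -- All `k`-tuples of vertex pairs are allowed; filtering by membership in `STSP n` avoids deciding
  -- which tuples are matchings.
  let s : Finset (Matrix (Fin n) (Fin n) ℝ) := (Finset.univ.image pt).filter (· ∈ STSP n)
  have hs : (s : Set (Matrix (Fin n) (Fin n) ℝ)) ⊆ STSP n := fun A hA =>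
    (Finset.mem_filter.1 hA).2
  have hcard : s.card ≤ 1 * n ^ (4 * k) := by
    calc s.card ≤ (Finset.univ.image pt).card := Finset.card_filter_le _ _
      _ ≤ Fintype.card (Fin k → Fin n × Fin n) := Finset.card_image_le
      _ = n ^ (2 * k) := by simp [pow_mul, pow_two]
      _ ≤ 1 * n ^ (4 * k) := by
        rw [one_mul]
        exact Nat.pow_le_pow_right (by lia) (by lia)
  have hX : ∀ A ∈ hamiltonianCycleMatrices n,
      stspBarycenter n + c • (A - stspBarycenter n) ∈
        convexHull ℝ (s : Set (Matrix (Fin n) (Fin n) ℝ)) := by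
    intro A hA
    obtain ⟨f, hf⟩ := exists_cyclic_enumeration hA
    rw [hc, ← sum_matchingPoint_cycleWindow hn hk h3 hA hf]
    refine (convex_convexHull ℝ _).sum_mem (fun _ _ => by positivity)
      (by simp [ZMod.card, hn0.ne']) fun j _ => subset_convexHull ℝ _ ?_
    refine Finset.mem_filter.2 ⟨Finset.mem_image_of_mem pt (Finset.mem_univ _), ?_⟩
    rw [edgesMatrix_cycleWindow_eq h3 hf]
    exact matchingPoint_mem hk h3 hA (card_endpoints_cycleWindow h3 j)
      (fun u hu => sum_endpoints_cycleWindow h3 hf j hu) h0 h1.le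
  obtain ⟨P, T, hP, hfacets, hsub, hsup⟩ := exists_simplex_projection hc0 hs hX
  refine ⟨s.card, P, T, c, hP, hfacets.trans (by exact_mod_cast hcard), hc0, ?_, hsub, hsup⟩
  -- The error is `mixWeight n k * k / n`, and `mixWeight n k * k ≤ 1` gives `D = 1`.
  have e : c - k / n = -(mixWeight n k * k / n) := by rw [hc]; ring
  rw [e, abs_neg, abs_of_nonneg (by positivity)]
  push_cast
  gcongr
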